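/- Let $A$ be a $C^*$-algebra and $E$ a Hilbert $C^*$-module over $A$. Let $L(E)$ be the bounded adjointable operators on $E$ and $K(E)$ the compact operators, i.e. the norm closure of the linear span of the maps $z\mapsto x\langle y,z\rangle$, $x,y\in E$. A closed densely defined ($A$-linear) operator $t:D(t)\subseteq E\to E$ with densely defined adjoint $t^*$ is called regular if $1+t^*t$ has dense range; it is selfadjoint if $t=t^*$. A regular operator $t$ is called Fredholm if there are $G,G'\in L(E)$ such that $Gt$ and $tG'$ are closable with closures $\overline{Gt},\overline{tG'}\in L(E)$ and $\overline{Gt}-1\in K(E)$, $\overline{tG'}-1\in K(E)$. The gap metric on regular operators is $g(t,s)=\|P_{G(t)}-P_{G(s)}\|$, where $P_{G(t)}$ is the orthogonal projection of $E\oplus E$ onto the graph $G(t)=\{(x,tx):x\in D(t)\}$. A selfadjoint bounded operator on $E$ is a $D\in L(E)$ with $D=D^*$; the operator $t+D$ has domain $D(t)$. Let $t$ be a selfadjoint regular Fredholm operator on $E$. Then: (1) There exists $\varepsilon>0$ such that $(\ast)$ $t+D$ is a selfadjoint regular Fredholm operator for every selfadjoint bounded operator $D$ on $E$ with $\|D\|\le\varepsilon$.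 (2) Let $\varepsilon>0$ be any number with property $(\ast)$, let $X$ be a topological space (for instance an interval of $\mathbb R$), and let $\lambda\mapsto A_\lambda$, $\lambda\in X$, be a norm-continuous family of selfadjoint bounded operators on $E$ with $\|A_\lambda\|\le\varepsilon$ for all $\lambda\in X$. Then every $t+A_\lambda$ is a selfadjoint regular Fredholm operator, and $\lambda\mapsto t+A_\lambda$ is continuous with respect to the gap metric. -/

import Mathlib

open Filter Topology
open scoped WithCStarModule

noncomputable section

namespace HilbertCStar

variable (A : Type*) {E : Type*} [NonUnitalCStarAlgebra A] [PartialOrder A] [StarOrderedRing A]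
  [NormedAddCommGroup E] [NormedSpace ℂ E] [SMul A E] [CStarModule A E]

/-! ### Elementary facts on the inner product -/

theorem ext_inner {x y : E} (h : ∀ w : E, inner A w x = inner A w y) : x = y := by
  have h0 : inner A (x - y) (x - y) = 0 := by
    rw [CStarModule.inner_sub_right, h, sub_self]
  exact sub_eq_zero.mp (CStarModule.inner_self.mp h0)

theorem add_smul_module (a b : A) (x : E) : (a + b) • x = a • x + b • x :=
  ext_inner A fun w => by simp [add_mul]

theorem complex_smul_assoc (c : ℂ) (a : A) (x : E) : (c • a) • x = c • a • x :=
  ext_inner A fun w => by simp [smul_mul_assoc]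

theorem norm_smul_le_module (a : A) (x : E) : ‖a • x‖ ≤ ‖a‖ * ‖x‖ := by
  have h : ‖a • x‖ ^ 2 ≤ (‖a‖ * ‖x‖) ^ 2 := by
    rw [CStarModule.norm_sq_eq A (x := a • x), mul_pow, CStarModule.norm_sq_eq A (x := x)]
    simp only [CStarModule.inner_op_smul_right, CStarModule.inner_op_smul_left]
    calc ‖a * (inner A x x * star a)‖ ≤ ‖a‖ * (‖inner A x x‖ * ‖star a‖) :=
          (norm_mul_le _ _).trans (mul_le_mul_of_nonneg_left (norm_mul_le _ _) (norm_nonneg _))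
      _ = ‖a‖ ^ 2 * ‖inner A x x‖ := by rw [norm_star]; ring
  exact le_of_sq_le_sq h (by positivity)

/-! ### Bounded adjointable operators and compact operators -/

/-- Membership in `L(E)`: the bounded operator `T` has an adjoint. -/
def IsAdjointable (T : E →L[ℂ] E) : Prop :=
  ∃ S : E →L[ℂ] E, ∀ x y : E, inner A (T x) y = inner A x (S y)

/-- A bounded adjointable operator with `T = T*`. -/
def IsSelfAdjointCLM (T : E →L[ℂ] E) : Prop :=
  ∀ x y : E, inner A (T x) y = inner A x (T y)

/-- The elementary operator `z ↦ ⟪y, z⟫ • x`. -/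
def theta (x y : E) : E →L[ℂ] E :=
  LinearMap.mkContinuous
    { toFun := fun z => (inner A y z : A) • x
      map_add' := fun z w => by rw [CStarModule.inner_add_right, add_smul_module]
      map_smul' := fun c z => by
        rw [CStarModule.inner_smul_right_complex, complex_smul_assoc, RingHom.id_apply] }
    (‖y‖ * ‖x‖) fun z => by
      calc ‖(inner A y z : A) • x‖ ≤ ‖(inner A y z : A)‖ * ‖x‖ := norm_smul_le_module A _ _
        _ ≤ (‖y‖ * ‖z‖) * ‖x‖ :=
          mul_le_mul_of_nonneg_right (CStarModule.norm_inner_le E) (norm_nonneg _)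
        _ = ‖y‖ * ‖x‖ * ‖z‖ := by ring

/-- `K(E)`: the operator-norm closure of the linear span of the elementary operators. -/
def compactOperators (E : Type*) [NormedAddCommGroup E] [NormedSpace ℂ E] [SMul A E]
    [CStarModule A E] : Submodule ℂ (E →L[ℂ] E) :=
  (Submodule.span ℂ {T | ∃ x y : E, T = theta A x y}).topologicalClosure

/-! ### Unbounded operators -/

/-- The graph of the adjoint: all `(y, z)` with `⟪t x, y⟫ = ⟪x, z⟫` for all `x` in `D(t)`. -/
def adjointGraph (t : E →ₗ.[ℂ] E) : Submodule ℂ (E × E) where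
  carrier := {p | ∀ x : t.domain, inner A (t x) p.1 = inner A (x : E) p.2}
  add_mem' := fun {p q} hp hq x => by
    rw [Prod.fst_add, Prod.snd_add, CStarModule.inner_add_right, CStarModule.inner_add_right,
      hp x, hq x]
  zero_mem' := fun x => by
    rw [Prod.fst_zero, Prod.snd_zero, CStarModule.inner_zero_right, CStarModule.inner_zero_right]
  smul_mem' := fun c p hp x => by
    rw [Prod.smul_fst, Prod.smul_snd, CStarModule.inner_smul_right_complex,
      CStarModule.inner_smul_right_complex, hp x]

/-- The adjoint `t*` (meaningful when `D(t)` is dense, see `adjoint_graph`). -/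
def adjoint (t : E →ₗ.[ℂ] E) : E →ₗ.[ℂ] E := (adjointGraph A t).toLinearPMap

theorem adjoint_graph {t : E →ₗ.[ℂ] E} (ht : Dense (t.domain : Set E)) :
    (adjoint A t).graph = adjointGraph A t := by
  refine Submodule.toLinearPMap_graph_eq _ ?_
  rintro ⟨y, z⟩ hp hy
  have hy' : y = 0 := hy
  subst hy'
  have hz : ∀ x : t.domain, inner A (x : E) z = 0 := fun x => by
    have := hp x
    rw [CStarModule.inner_zero_right] at this
    exact this.symm
  have hc : Continuous fun x : E => inner A x z :=
    (CStarModule.continuous_inner (A := A) (E := E)).comp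
      (continuous_id.prodMk continuous_const)
  have h0 : (fun x : E => inner A x z) = fun _ => (0 : A) :=
    hc.ext_on ht continuous_const fun x hx => hz ⟨x, hx⟩
  exact CStarModule.inner_self.mp (congrFun h0 z)

/-- The range of `1 + t* t`, on its natural domain `{x ∈ D(t) | t x ∈ D(t*)}`. -/
def rangeOneAdd (t : E →ₗ.[ℂ] E) : Set E :=
  {u | ∃ x y z : E, (x, y) ∈ t.graph ∧ (y, z) ∈ (adjoint A t).graph ∧ u = x + z}

/-- Regular operators: closed densely defined `A`-linear operators with densely defined adjoint
such that `1 + t* t` has dense range. -/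
structure IsRegular (t : E →ₗ.[ℂ] E) : Prop where
  smul_mem_graph : ∀ (a : A) (x y : E), (x, y) ∈ t.graph → (a • x, a • y) ∈ t.graph
  isClosed : t.IsClosed
  dense_domain : Dense (t.domain : Set E)
  dense_adjoint_domain : Dense ((adjoint A t).domain : Set E)
  dense_range : Dense (rangeOneAdd A t)

/-- The product `t G` on its natural domain `{x | G x ∈ D(t)}`. -/
def compCLM (t : E →ₗ.[ℂ] E) (G : E →L[ℂ] E) : E →ₗ.[ℂ] E where
  domain := t.domain.comap (G : E →ₗ[ℂ] E)
  toFun :=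
    { toFun := fun x => t ⟨G x, x.2⟩
      map_add' := fun x y => by
        rw [← t.map_add]; congr 1; exact Subtype.ext (map_add G (x : E) (y : E))
      map_smul' := fun c x => by
        rw [RingHom.id_apply, ← t.map_smul]; congr 1
        exact Subtype.ext (map_smul G c (x : E)) }

/-- `s` is closable, its closure belongs to `L(E)`, and the closure is `1` modulo `K(E)`. -/
def ClosureIsOneModCompact (s : E →ₗ.[ℂ] E) : Prop :=
  s.IsClosable ∧ ∃ T : E →L[ℂ] E, IsAdjointable A T ∧
    s.closure = (T : E →ₗ[ℂ] E).toPMap ⊤ ∧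
    T - ContinuousLinearMap.id ℂ E ∈ compactOperators A E

/-- `G ∈ L(E)` is a pseudo left inverse of `t`. -/
def IsPseudoLeftInverse (t : E →ₗ.[ℂ] E) (G : E →L[ℂ] E) : Prop :=
  IsAdjointable A G ∧ ClosureIsOneModCompact A ((G : E →ₗ[ℂ] E).compPMap t)

/-- `G ∈ L(E)` is a pseudo right inverse of `t`. -/
def IsPseudoRightInverse (t : E →ₗ.[ℂ] E) (G : E →L[ℂ] E) : Prop :=
  IsAdjointable A G ∧ ClosureIsOneModCompact A (compCLM t G)

/-- Selfadjoint regular Fredholm operators. -/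
structure IsSelfAdjointRegularFredholm (t : E →ₗ.[ℂ] E) : Prop where
  regular : IsRegular A t
  selfAdjoint : adjoint A t = t
  pseudoLeft : ∃ G : E →L[ℂ] E, IsPseudoLeftInverse A t G
  pseudoRight : ∃ G : E →L[ℂ] E, IsPseudoRightInverse A t G

/-- The sum `t + D` of an operator and a bounded operator, with domain `D(t)`. -/
def addCLM (t : E →ₗ.[ℂ] E) (D : E →L[ℂ] E) : E →ₗ.[ℂ] E := (D : E →ₗ[ℂ] E) +ᵥ t

/-- `ε > 0` is such that `t + D` is selfadjoint regular Fredholm for every selfadjoint bounded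
operator `D` with `‖D‖ ≤ ε`. -/
def IsFredholmStabilityRadius (t : E →ₗ.[ℂ] E) (ε : ℝ) : Prop :=
  0 < ε ∧ ∀ D : E →L[ℂ] E, IsSelfAdjointCLM A D → ‖D‖ ≤ ε →
    IsSelfAdjointRegularFredholm A (addCLM t D)

/-! ### The gap metric -/

/-- The graph of `t` as a subspace of the Hilbert module `E ⊕ E`. -/
def graphSubmodule (t : E →ₗ.[ℂ] E) : Submodule ℂ C⋆ᵐᵒᵈ(A, E × E) :=
  t.graph.comap (WithCStarModule.linearEquiv ℂ A (E × E)).toLinearMap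

/-- `P` is the orthogonal projection of `E ⊕ E` onto the graph of `t`. -/
def IsGraphProjection (t : E →ₗ.[ℂ] E)
    (P : C⋆ᵐᵒᵈ(A, E × E) →L[ℂ] C⋆ᵐᵒᵈ(A, E × E)) : Prop :=
  ∀ u : C⋆ᵐᵒᵈ(A, E × E), P u ∈ graphSubmodule A t ∧
    ∀ v ∈ graphSubmodule A t, inner A v (u - P u) = 0

open Classical in
/-- The orthogonal projection onto the graph of `t` (when the graph is orthogonally complemented,
in particular for every regular `t`). -/
def graphProjection (t : E →ₗ.[ℂ] E) : C⋆ᵐᵒᵈ(A, E × E) →L[ℂ] C⋆ᵐᵒᵈ(A, E × E) :=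
  if h : ∃ P, IsGraphProjection A t P then h.choose else 0

/-- The gap distance `g(t, s) = ‖P_{G(t)} - P_{G(s)}‖`. -/
def gapDist (t s : E →ₗ.[ℂ] E) : ℝ := ‖graphProjection A t - graphProjection A s‖

/-- Continuity of a family of operators with respect to the gap metric; the first clause says
that the gap distances involved are the genuine ones. -/
def IsGapContinuous {X : Type*} [TopologicalSpace X] (f : X → (E →ₗ.[ℂ] E)) : Prop :=
  (∀ l : X, IsGraphProjection A (f l) (graphProjection A (f l))) ∧
  ∀ l₀ : X, Tendsto (fun l => gapDist A (f l) (f l₀)) (𝓝 l₀) (𝓝 0)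

end HilbertCStar

end

noncomputable section

namespace HilbertCStar

variable (A : Type*) {E : Type*} [NonUnitalCStarAlgebra A] [PartialOrder A] [StarOrderedRing A]
  [NormedAddCommGroup E] [NormedSpace ℂ E] [SMul A E] [CStarModule A E]

/-! ### Adjointable operators -/

/-! Everything runs through the resolvents at `c = ±i`. For symmetric `s` the cross terms cancel, so
`⟪(s+c)x, (s+c)x'⟫ = ⟪x, x'⟫ + ⟪s x, s x'⟫` (`IsSymmetricGraph.inner_add_smul`). Hence `s + c` is
bounded below, and has closed range if `s` is closed. Since `1 + s² = (s+c)(s-c)`, a selfadjoint `s`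
is regular exactly when both `(s ± i)⁻¹` are everywhere defined contractions.

Stability: `t + D + c = (1 + D R)(t + c)` with `R = (t+c)⁻¹`, so a Neumann series keeps the
resolvents, hence regularity, for `‖D‖ < 1`. If `G t` extends to `T`, then `G(t+D)` extends to `T +
G D`, and `W = (1 + G D)⁻¹` gives `W(T + G D) - 1 = W(T - 1)`, which is compact; the right inverse
is treated symmetrically.

Gap continuity: by the same identity `V w = (R w, w - i R w)`, with `R = (s+i)⁻¹`, is an isometry
onto the graph, so `V V*` is the graph projection (`isGraphProjection_comp`). Resolvents depend on
`D` with Lipschitz constant 1, so the gap distance is at most `12 ‖D - D'‖`. -/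

/-- `S` is the adjoint of the bounded operator `T`. -/
def IsAdjointPair (T S : E →L[ℂ] E) : Prop :=
  ∀ x y : E, inner A (T x) y = inner A x (S y)

variable {A}

theorem IsAdjointPair.symm {T S : E →L[ℂ] E} (h : IsAdjointPair A T S) : IsAdjointPair A S T :=
  fun x y => by
    rw [← CStarModule.star_inner (A := A) y (S x), ← h y x, CStarModule.star_inner]

theorem IsAdjointPair.add {T S T' S' : E →L[ℂ] E} (h : IsAdjointPair A T S)
    (h' : IsAdjointPair A T' S') : IsAdjointPair A (T + T') (S + S') := fun x y => by
  simp [h x y, h' x y]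

theorem IsAdjointPair.comp {T S T' S' : E →L[ℂ] E} (h : IsAdjointPair A T S)
    (h' : IsAdjointPair A T' S') : IsAdjointPair A (T ∘L T') (S' ∘L S) := fun x y => by
  rw [ContinuousLinearMap.comp_apply, h, h', ContinuousLinearMap.comp_apply]

theorem IsAdjointPair.map_smul {T S : E →L[ℂ] E} (h : IsAdjointPair A T S) (a : A) (x : E) :
    T (a • x) = a • T x :=
  ext_inner A fun w => by
    rw [← h.symm, CStarModule.inner_op_smul_right, CStarModule.inner_op_smul_right, h.symm]

theorem IsAdjointPair.comp_theta {T S : E →L[ℂ] E} (h : IsAdjointPair A T S) (x y : E) :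
    T ∘L theta A x y = theta A (T x) y :=
  ContinuousLinearMap.ext fun z => h.map_smul (inner A y z) x

theorem IsAdjointPair.theta_comp {T S : E →L[ℂ] E} (h : IsAdjointPair A T S) (x y : E) :
    theta A x y ∘L T = theta A x (S y) :=
  ContinuousLinearMap.ext fun z => by
    change (inner A y (T z) : A) • x = (inner A (S y) z : A) • x
    rw [h.symm]

/-- A continuous linear map of `L(E)` that maps elementary operators to elementary operators
preserves compactness. -/
theorem map_mem_compactOperators (L : (E →L[ℂ] E) →L[ℂ] (E →L[ℂ] E))
    (hL : ∀ x y : E, ∃ x' y' : E, L (theta A x y) = theta A x' y') {K : E →L[ℂ] E}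
    (hK : K ∈ compactOperators A E) : L K ∈ compactOperators A E := by
  have hle : compactOperators A E ≤ (compactOperators A E).comap L.toLinearMap := by
    refine Submodule.topologicalClosure_minimal _ (Submodule.span_le.mpr ?_) ?_
    · rintro _ ⟨x, y, rfl⟩
      exact Submodule.le_topologicalClosure _ (Submodule.subset_span (hL x y))
    · exact (Submodule.isClosed_topologicalClosure _).preimage L.continuous
  exact hle hK

theorem IsAdjointPair.comp_mem_compactOperators {T S K : E →L[ℂ] E} (h : IsAdjointPair A T S)
    (hK : K ∈ compactOperators A E) : T ∘L K ∈ compactOperators A E :=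
  map_mem_compactOperators (ContinuousLinearMap.compL ℂ E E E T)
    (fun x y => ⟨T x, y, h.comp_theta x y⟩) hK

theorem IsAdjointPair.mem_compactOperators_comp {T S K : E →L[ℂ] E} (h : IsAdjointPair A T S)
    (hK : K ∈ compactOperators A E) : K ∘L T ∈ compactOperators A E :=
  map_mem_compactOperators ((ContinuousLinearMap.compL ℂ E E E).flip T)
    (fun x y => ⟨x, S y, h.theta_comp x y⟩) hK

theorem exists_inverse_one_add [CompleteSpace E] {T : E →L[ℂ] E} (hT : ‖T‖ < 1) :
    ∃ W : E →L[ℂ] E, W * (1 + T) = 1 ∧ (1 + T) * W = 1 := by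
  have hT' : ‖-T‖ < 1 := by rwa [norm_neg]
  refine ⟨((Units.oneSub (-T) hT')⁻¹ : (E →L[ℂ] E)ˣ), ?_, ?_⟩
  · have := (Units.oneSub (-T) hT').inv_mul
    rwa [Units.val_oneSub, sub_neg_eq_add] at this
  · have := (Units.oneSub (-T) hT').mul_inv
    rwa [Units.val_oneSub, sub_neg_eq_add] at this

/-- The adjoint of `(1 + T)⁻¹` is `(1 + S)⁻¹`. Both norms are assumed small, so `‖S‖ = ‖T‖` is not
needed. -/
theorem IsAdjointPair.exists_inverse_one_add [CompleteSpace E] {T S : E →L[ℂ] E}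
    (h : IsAdjointPair A T S) (hT : ‖T‖ < 1) (hS : ‖S‖ < 1) :
    ∃ W W' : E →L[ℂ] E, IsAdjointPair A W W' ∧ W * (1 + T) = 1 ∧ (1 + T) * W = 1 := by
  obtain ⟨W, h1, h2⟩ := HilbertCStar.exists_inverse_one_add hT
  obtain ⟨W', -, h3⟩ := HilbertCStar.exists_inverse_one_add hS
  refine ⟨W, W', fun x y => ?_, h1, h2⟩
  have hadd : IsAdjointPair A (1 + T) (1 + S) := IsAdjointPair.add (fun _ _ => rfl) h
  have e2 : (1 + T) (W x) = x := DFunLike.congr_fun h2 x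
  have e3 : (1 + S) (W' y) = y := DFunLike.congr_fun h3 y
  calc inner A (W x) y = inner A (W x) ((1 + S) (W' y)) := by rw [e3]
    _ = inner A x (W' y) := by rw [← hadd, e2]

/-! ### Closures and compact perturbations of the identity -/

/-- The graph of a bounded `T` is closed and is the continuous image of `x ↦ (x, T x)`, so
restricting `T` to a dense domain and closing recovers it. This removes closures from the Fredholm
condition. -/
theorem isClosable_and_closure_eq_iff {s : E →ₗ.[ℂ] E} {T : E →L[ℂ] E} :
    (s.IsClosable ∧ s.closure = (T : E →ₗ[ℂ] E).toPMap ⊤) ↔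
      Dense (s.domain : Set E) ∧ ∀ x : s.domain, s x = T x := by
  have hgraph : ∀ x y : E, (x, y) ∈ ((T : E →ₗ[ℂ] E).toPMap ⊤).graph ↔ y = T x := by
    intro x y
    rw [LinearPMap.mem_graph_iff]
    constructor
    · rintro ⟨z, rfl, rfl⟩
      rfl
    · rintro rfl
      exact ⟨⟨x, trivial⟩, rfl, rfl⟩
  constructor
  · rintro ⟨hs, hc⟩
    refine ⟨fun x => ?_, fun x => ?_⟩
    · have hx : (x, T x) ∈ s.graph.topologicalClosure := by
        rw [hs.graph_closure_eq_closure_graph, hc, hgraph]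
      exact map_mem_closure continuous_fst hx fun p hp => LinearPMap.mem_domain_of_mem_graph hp
    · have := LinearPMap.le_graph_of_le s.le_closure (s.mem_graph x)
      rwa [hc, hgraph] at this
  · rintro ⟨hd, hT⟩
    have key : s.graph.topologicalClosure = ((T : E →ₗ[ℂ] E).toPMap ⊤).graph := by
      apply le_antisymm
      · refine Submodule.topologicalClosure_minimal _ ?_ ?_
        · rintro ⟨x, y⟩ hp
          obtain ⟨z, rfl, rfl⟩ := (LinearPMap.mem_graph_iff s).mp hp
          exact (hgraph _ _).mpr (hT z)
        · have : (((T : E →ₗ[ℂ] E).toPMap ⊤).graph : Set (E × E)) = {p | p.2 = T p.1} :=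
            Set.ext fun p => hgraph p.1 p.2
          rw [this]
          exact isClosed_eq continuous_snd (T.continuous.comp continuous_fst)
      · rintro ⟨x, y⟩ hp
        obtain rfl := (hgraph _ _).mp hp
        have hcont : Continuous fun z : E => (z, T z) := continuous_id.prodMk T.continuous
        refine map_mem_closure (f := fun z : E => (z, T z)) hcont (hd x) fun z hz => ?_
        have := s.mem_graph ⟨z, hz⟩
        rwa [hT] at this
    have hs : s.IsClosable := ⟨_, key⟩
    exact ⟨hs, LinearPMap.eq_of_eq_graph (hs.graph_closure_eq_closure_graph.symm.trans key)⟩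

theorem closureIsOneModCompact_iff {s : E →ₗ.[ℂ] E} :
    ClosureIsOneModCompact A s ↔ Dense (s.domain : Set E) ∧ ∃ T S : E →L[ℂ] E,
      IsAdjointPair A T S ∧ (∀ x : s.domain, s x = T x) ∧ T - 1 ∈ compactOperators A E := by
  constructor
  · rintro ⟨hs, T, ⟨S, hTS⟩, hc, hK⟩
    obtain ⟨hd, hT⟩ := isClosable_and_closure_eq_iff.mp ⟨hs, hc⟩
    exact ⟨hd, T, S, hTS, hT, hK⟩
  · rintro ⟨hd, T, S, hTS, hT, hK⟩
    obtain ⟨hs, hc⟩ := isClosable_and_closure_eq_iff.mpr ⟨hd, hT⟩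
    exact ⟨hs, T, ⟨S, hTS⟩, hc, hK⟩

theorem exists_isPseudoLeftInverse_addCLM [CompleteSpace E] {t : E →ₗ.[ℂ] E} {G G' D D' : E →L[ℂ] E}
    (hG : IsAdjointPair A G G') (hD : IsAdjointPair A D D') (ht : IsPseudoLeftInverse A t G)
    (h1 : ‖G ∘L D‖ < 1) (h2 : ‖D' ∘L G'‖ < 1) :
    ∃ H : E →L[ℂ] E, IsPseudoLeftInverse A (addCLM t D) H := by
  obtain ⟨hd, T, S, hTS, hT, hK⟩ := closureIsOneModCompact_iff.mp ht.2
  obtain ⟨W, W', hW, hW1, -⟩ := (hG.comp hD).exists_inverse_one_add h1 h2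
  refine ⟨W ∘L G, ⟨_, hW.comp hG⟩, closureIsOneModCompact_iff.mpr
    ⟨hd, W ∘L (T + G ∘L D), _, hW.comp (hTS.add (hG.comp hD)), fun x => ?_, ?_⟩⟩
  · change W (G (D x + t x)) = W (T x + G (D x))
    rw [← show G (t x) = T x from hT x, map_add, add_comm]
  · have e : W ∘L (T + G ∘L D) - 1 = W ∘L (T - 1) := by
      change W * (T + G ∘L D) - 1 = W * (T - 1)
      rw [mul_add, mul_one] at hW1
      rw [mul_add, mul_sub, mul_one, ← hW1]
      abel
    rw [e]
    exact hW.comp_mem_compactOperators hK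

theorem exists_isPseudoRightInverse_addCLM [CompleteSpace E] {t : E →ₗ.[ℂ] E}
    {G G' D D' : E →L[ℂ] E}
    (hG : IsAdjointPair A G G') (hD : IsAdjointPair A D D') (ht : IsPseudoRightInverse A t G)
    (h1 : ‖D ∘L G‖ < 1) (h2 : ‖G' ∘L D'‖ < 1) :
    ∃ H : E →L[ℂ] E, IsPseudoRightInverse A (addCLM t D) H := by
  obtain ⟨hd, T, S, hTS, hT, hK⟩ := closureIsOneModCompact_iff.mp ht.2
  obtain ⟨W, W', hW, hW1, hW2⟩ := (hD.comp hG).exists_inverse_one_add h1 h2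
  have hWM : ∀ x, W ((1 + D ∘L G : E →L[ℂ] E) x) = x := DFunLike.congr_fun hW1
  have hMW : ∀ x, (1 + D ∘L G : E →L[ℂ] E) (W x) = x := DFunLike.congr_fun hW2
  refine ⟨G ∘L W, ⟨_, hG.comp hW⟩, closureIsOneModCompact_iff.mpr
    ⟨?_, (T + D ∘L G) ∘L W, _, (hTS.add (hD.comp hG)).comp hW, fun x => ?_, ?_⟩⟩
  · have hsurj : Function.Surjective (1 + D ∘L G : E →L[ℂ] E) := fun x => ⟨W x, hMW x⟩
    -- The domain of `(t + D) G W` contains the image of the dense domain of `t G` under the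
    -- continuous surjection `1 + D G`.
    refine (hsurj.denseRange.dense_image (1 + D ∘L G : E →L[ℂ] E).continuous hd).mono ?_
    rintro _ ⟨x, hx, rfl⟩
    change G (W ((1 + D ∘L G : E →L[ℂ] E) x)) ∈ t.domain
    rw [hWM]
    exact hx
  · change D (G (W x)) + t ⟨G (W x), x.2⟩ = T (W x) + D (G (W x))
    rw [← show t ⟨G (W x), x.2⟩ = T (W x) from hT ⟨W x, x.2⟩, add_comm]
  · have e : (T + D ∘L G) ∘L W - 1 = (T - 1) ∘L W := by
      change (T + D ∘L G) * W - 1 = (T - 1) * W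
      rw [add_mul, one_mul] at hW2
      rw [add_mul, sub_mul, one_mul, ← hW2]
      abel
    rw [e]
    exact hW.mem_compactOperators_comp hK

/-! ### Selfadjoint operators and their resolvents -/

theorem mem_graph_addCLM {t : E →ₗ.[ℂ] E} {D : E →L[ℂ] E} {x y : E} :
    (x, y) ∈ (addCLM t D).graph ↔ (x, y - D x) ∈ t.graph := by
  rw [LinearPMap.mem_graph_iff, LinearPMap.mem_graph_iff]
  constructor
  · rintro ⟨z, rfl, rfl⟩
    exact ⟨z, rfl, (add_sub_cancel_left (D z) (t z)).symm⟩
  · rintro ⟨z, rfl, hz⟩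
    exact ⟨z, rfl, by
      change D z + t z = y
      rw [hz]
      exact add_sub_cancel _ _⟩

variable (A)

/-- The graph of `s` is symmetric: `⟪s x, y⟫ = ⟪x, s y⟫` on the domain of `s`. -/
def IsSymmetricGraph (s : E →ₗ.[ℂ] E) : Prop :=
  ∀ x y x' y' : E, (x, y) ∈ s.graph → (x', y') ∈ s.graph → inner A y x' = inner A x y'

variable {A}

theorem mem_graph_iff_of_adjoint_eq {s : E →ₗ.[ℂ] E} (hd : Dense (s.domain : Set E))
    (hs : adjoint A s = s) {y z : E} :
    (y, z) ∈ s.graph ↔ ∀ x : s.domain, inner A (s x) y = inner A (x : E) z := by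
  have h := adjoint_graph A hd
  rw [hs] at h
  rw [h]
  rfl

theorem isSymmetricGraph_of_adjoint_eq {s : E →ₗ.[ℂ] E} (hd : Dense (s.domain : Set E))
    (hs : adjoint A s = s) : IsSymmetricGraph A s := by
  intro x y x' y' h h'
  obtain ⟨z, rfl, rfl⟩ := (LinearPMap.mem_graph_iff s).mp h
  exact (mem_graph_iff_of_adjoint_eq hd hs).mp h' z

theorem adjoint_addCLM {t : E →ₗ.[ℂ] E} (hd : Dense (t.domain : Set E))
    (ht : adjoint A t = t) {D : E →L[ℂ] E} (hD : IsSelfAdjointCLM A D) :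
    adjoint A (addCLM t D) = addCLM t D := by
  have hd' : Dense ((addCLM t D).domain : Set E) := hd
  apply LinearPMap.eq_of_eq_graph
  rw [adjoint_graph A hd']
  ext ⟨y, z⟩
  rw [mem_graph_addCLM, mem_graph_iff_of_adjoint_eq hd ht]
  refine forall_congr' fun x => ?_
  change inner A (D x + t x) y = inner A (x : E) z ↔ inner A (t x) y = inner A (x : E) (z - D y)
  rw [CStarModule.inner_add_left, CStarModule.inner_sub_right, hD]
  exact eq_sub_iff_add_eq'.symm

theorem isSelfAdjoint_isClosed {s : E →ₗ.[ℂ] E} (hd : Dense (s.domain : Set E))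
    (hs : adjoint A s = s) : s.IsClosed := by
  have h : (s.graph : Set (E × E)) =
      ⋂ x : s.domain, {p : E × E | inner A (s x) p.1 = inner A (x : E) p.2} := by
    ext p
    rw [Set.mem_iInter]
    exact mem_graph_iff_of_adjoint_eq hd hs
  have hc : ∀ x : E, Continuous fun y : E => inner A x y := fun x =>
    (CStarModule.continuous_inner (A := A) (E := E)).comp (continuous_const.prodMk continuous_id)
  rw [LinearPMap.IsClosed, h]
  exact isClosed_iInter fun x =>
    isClosed_eq ((hc _).comp continuous_fst) ((hc _).comp continuous_snd)

/-- The imaginary units `i` and `-i`. -/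
def IsImaginaryUnit (c : ℂ) : Prop := star c = -c ∧ c * c = -1

theorem isImaginaryUnit_I : IsImaginaryUnit Complex.I := ⟨by simp, by simp⟩

theorem isImaginaryUnit_neg_I : IsImaginaryUnit (-Complex.I) := ⟨by simp, by simp⟩

theorem IsSymmetricGraph.inner_add_smul {s : E →ₗ.[ℂ] E} (hs : IsSymmetricGraph A s) {c : ℂ}
    (hc : IsImaginaryUnit c) {x y x' y' : E} (h : (x, y) ∈ s.graph) (h' : (x', y') ∈ s.graph) :
    inner A (y + c • x) (y' + c • x') = inner A x x' + inner A y y' := by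
  have hcc : ∀ a : A, c • c • a = -a := fun a => by rw [smul_smul, hc.2, neg_one_smul]
  simp only [CStarModule.inner_add_left, CStarModule.inner_add_right,
    CStarModule.inner_smul_left_complex, CStarModule.inner_smul_right_complex, hc.1,
    hs x y x' y' h h', neg_smul, smul_neg, smul_add, hcc, neg_neg]
  abel

theorem IsSymmetricGraph.norm_le {s : E →ₗ.[ℂ] E} (hs : IsSymmetricGraph A s) {c : ℂ}
    (hc : IsImaginaryUnit c) {x y : E} (h : (x, y) ∈ s.graph) :
    ‖x‖ ≤ ‖y + c • x‖ ∧ ‖y‖ ≤ ‖y + c • x‖ := by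
  have hx : (0 : A) ≤ inner A x x := CStarModule.inner_self_nonneg
  have hy : (0 : A) ≤ inner A y y := CStarModule.inner_self_nonneg
  constructor
  · refine le_of_sq_le_sq ?_ (norm_nonneg _)
    rw [CStarModule.norm_sq_eq A, CStarModule.norm_sq_eq A, hs.inner_add_smul hc h h]
    exact CStarAlgebra.norm_le_norm_of_nonneg_of_le hx (le_add_of_nonneg_right hy)
  · refine le_of_sq_le_sq ?_ (norm_nonneg _)
    rw [CStarModule.norm_sq_eq A, CStarModule.norm_sq_eq A, hs.inner_add_smul hc h h]
    exact CStarAlgebra.norm_le_norm_of_nonneg_of_le hy (le_add_of_nonneg_left hx)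

/-- `R` is the bounded right inverse of `s + c`. -/
def IsResolvent (s : E →ₗ.[ℂ] E) (c : ℂ) (R : E →L[ℂ] E) : Prop :=
  ∀ w : E, (R w, w - c • R w) ∈ s.graph

theorem IsResolvent.norm_apply_le {s : E →ₗ.[ℂ] E} {c : ℂ} {R : E →L[ℂ] E}
    (hR : IsResolvent s c R) (hs : IsSymmetricGraph A s) (hc : IsImaginaryUnit c) (w : E) :
    ‖R w‖ ≤ ‖w‖ := by
  simpa using (hs.norm_le hc (hR w)).1

theorem IsResolvent.norm_le_one {s : E →ₗ.[ℂ] E} {c : ℂ} {R : E →L[ℂ] E}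
    (hR : IsResolvent s c R) (hs : IsSymmetricGraph A s) (hc : IsImaginaryUnit c) : ‖R‖ ≤ 1 :=
  R.opNorm_le_bound zero_le_one fun w => by simpa using hR.norm_apply_le hs hc w

/-- Apply symmetry to `(R x, x - c R x)` and `(S y, y + c S y)`; as `c` is imaginary, the terms in
`c` agree on both sides. -/
theorem IsResolvent.isAdjointPair {s : E →ₗ.[ℂ] E} {c : ℂ} {R S : E →L[ℂ] E}
    (hR : IsResolvent s c R) (hS : IsResolvent s (-c) S) (hs : IsSymmetricGraph A s)
    (hc : IsImaginaryUnit c) : IsAdjointPair A R S := fun x y => by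
  have h := hs _ _ _ _ (hR x) (hS y)
  simp only [CStarModule.inner_sub_left, CStarModule.inner_sub_right,
    CStarModule.inner_smul_left_complex, CStarModule.inner_smul_right_complex, hc.1] at h
  exact (sub_left_inj.mp h).symm

theorem IsResolvent.apply_eq {s : E →ₗ.[ℂ] E} {c : ℂ} {R : E →L[ℂ] E} (hR : IsResolvent s c R)
    (hs : IsSymmetricGraph A s) (hc : IsImaginaryUnit c) {x y : E} (h : (x, y) ∈ s.graph) :
    R (y + c • x) = x := by
  have h1 := s.graph.sub_mem (hR (y + c • x)) h
  have h2 := (hs.norm_le hc h1).1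
  have e : y + c • x - c • R (y + c • x) - y + c • (R (y + c • x) - x) = 0 := by module
  rw [e, norm_zero] at h2
  exact sub_eq_zero.mp (norm_le_zero_iff.mp h2)

/-- On the complete space `s.graph` the map `L = s + c` is continuous and bounded below, so its
range is closed; being dense, it is everything, and `R` is the first coordinate of `L⁻¹`. -/
theorem exists_isResolvent_of_dense [CompleteSpace E] {s : E →ₗ.[ℂ] E}
    (hs : IsSymmetricGraph A s) (hcl : s.IsClosed) {c : ℂ} (hc : IsImaginaryUnit c)
    (hd : Dense {u : E | ∃ x y : E, (x, y) ∈ s.graph ∧ u = y + c • x}) :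
    ∃ R : E →L[ℂ] E, IsResolvent s c R := by
  let L : s.graph →ₗ[ℂ] E :=
    (LinearMap.snd ℂ E E + c • LinearMap.fst ℂ E E) ∘ₗ s.graph.subtype
  have hL : ∀ p : s.graph, L p = (p : E × E).2 + c • (p : E × E).1 := fun _ => rfl
  have hbound : ∀ p : s.graph, ‖p‖ ≤ ‖L p‖ := fun p =>
    max_le (hs.norm_le hc p.2).1 (hs.norm_le hc p.2).2
  have hanti : AntilipschitzWith 1 L :=
    AddMonoidHomClass.antilipschitz_of_bound L fun p => by simpa using hbound p
  have hcont : Continuous L := by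
    refine (Continuous.add continuous_snd (continuous_fst.const_smul c)).comp
      continuous_subtype_val
  have : CompleteSpace s.graph := hcl.completeSpace_coe
  have huc : UniformContinuous L := uniformContinuous_addMonoidHom_of_continuous hcont
  have hsurj : Function.Surjective L := by
    rw [← Set.range_eq_univ, ← (hanti.isClosed_range huc).closure_eq]
    refine (hd.mono ?_).closure_eq
    rintro _ ⟨x, y, hxy, rfl⟩
    exact ⟨⟨(x, y), hxy⟩, rfl⟩
  let e := LinearEquiv.ofBijective L ⟨hanti.injective, hsurj⟩
  have he : ∀ w, L (e.symm w) = w := fun w => e.apply_symm_apply w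
  refine ⟨LinearMap.mkContinuous
    (LinearMap.fst ℂ E E ∘ₗ s.graph.subtype ∘ₗ e.symm.toLinearMap) 1 fun w => ?_, fun w => ?_⟩
  · rw [one_mul]
    have h := hbound (e.symm w)
    rw [he] at h
    exact (norm_fst_le (e.symm w : E × E)).trans h
  · have h : (e.symm w : E × E).2 = w - c • (e.symm w : E × E).1 :=
      eq_sub_of_add_eq (he w)
    change ((e.symm w : E × E).1, w - c • (e.symm w : E × E).1) ∈ s.graph
    rw [← h]
    exact (e.symm w).2

theorem IsRegular.exists_isResolvent [CompleteSpace E] {s : E →ₗ.[ℂ] E} (hr : IsRegular A s)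
    (hs : adjoint A s = s) {c : ℂ} (hc : IsImaginaryUnit c) :
    ∃ R : E →L[ℂ] E, IsResolvent s c R := by
  refine exists_isResolvent_of_dense (isSymmetricGraph_of_adjoint_eq hr.dense_domain hs)
    hr.isClosed hc (hr.dense_range.mono ?_)
  rintro _ ⟨x, y, z, hxy, hyz, rfl⟩
  rw [hs] at hyz
  -- With `y = s x` and `z = s y`, this is `x + s² x = (s + c)((s - c) x)`.
  refine ⟨y - c • x, z - c • y, s.graph.sub_mem hyz (s.graph.smul_mem c hxy), ?_⟩
  rw [smul_sub, smul_smul, hc.2, neg_one_smul]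
  abel

/-- From `s + D + c = (1 + D R)(s + c)` on the domain of `s`, the new resolvent is `R (1 + D R)⁻¹`.
-/
theorem IsResolvent.exists_addCLM [CompleteSpace E] {s : E →ₗ.[ℂ] E} {c : ℂ} {R D : E →L[ℂ] E}
    (hR : IsResolvent s c R) (hRD : ‖D ∘L R‖ < 1) :
    ∃ R' : E →L[ℂ] E, IsResolvent (addCLM s D) c R' := by
  obtain ⟨W, -, hW⟩ := exists_inverse_one_add hRD
  refine ⟨R ∘L W, fun w => mem_graph_addCLM.mpr ?_⟩
  have h : W w + D (R (W w)) = w := DFunLike.congr_fun hW w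
  have e : w - c • R (W w) - D (R (W w)) = W w - c • R (W w) := by
    nth_rewrite 1 [← h]
    abel
  change (R (W w), w - c • R (W w) - D (R (W w))) ∈ s.graph
  rw [e]
  exact hR (W w)

/-- The solution of `(1 + s²) x = u` is `x = R (S u)`, by `1 + s² = (s - c)(s + c)`. -/
theorem rangeOneAdd_eq_univ {s : E →ₗ.[ℂ] E} (hs : adjoint A s = s) {c : ℂ}
    (hc : IsImaginaryUnit c) {R S : E →L[ℂ] E} (hR : IsResolvent s c R)
    (hS : IsResolvent s (-c) S) : rangeOneAdd A s = Set.univ := by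
  refine Set.eq_univ_of_forall fun u => ?_
  have h1 := hS u
  have h2 := hR (S u)
  refine ⟨_, _, u - -c • S u - c • (S u - c • R (S u)), h2, ?_, ?_⟩
  · rw [hs]
    exact s.graph.sub_mem h1 (s.graph.smul_mem c h2)
  · have : c • c • R (S u) = -R (S u) := by rw [smul_smul, hc.2, neg_one_smul]
    rw [smul_sub, this]
    module

theorem IsRegular.addCLM [CompleteSpace E] {t : E →ₗ.[ℂ] E} (hr : IsRegular A t)
    (ht : adjoint A t = t) {D : E →L[ℂ] E} (hD : IsSelfAdjointCLM A D) (hn : ‖D‖ < 1) :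
    IsRegular A (addCLM t D) := by
  have hsym := isSymmetricGraph_of_adjoint_eq hr.dense_domain ht
  have hadj := adjoint_addCLM hr.dense_domain ht hD
  have hd : Dense ((HilbertCStar.addCLM t D).domain : Set E) := hr.dense_domain
  have key : ∀ c : ℂ, IsImaginaryUnit c →
      ∃ R : E →L[ℂ] E, IsResolvent (HilbertCStar.addCLM t D) c R := by
    intro c hc
    obtain ⟨R, hR⟩ := hr.exists_isResolvent ht hc
    refine hR.exists_addCLM ((D.opNorm_comp_le R).trans_lt ?_)
    exact (mul_le_of_le_one_right (norm_nonneg _) (hR.norm_le_one hsym hc)).trans_lt hn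
  obtain ⟨R, hR⟩ := key _ isImaginaryUnit_I
  obtain ⟨S, hS⟩ := key _ isImaginaryUnit_neg_I
  refine ⟨fun a x y h => ?_, isSelfAdjoint_isClosed hd hadj, hd, hadj.symm ▸ hd, ?_⟩
  · rw [mem_graph_addCLM] at h ⊢
    have h' := hr.smul_mem_graph a _ _ h
    -- `D` is `A`-linear because it has an adjoint, namely itself.
    have e : a • (y - D x) = a • y - D (a • x) := ext_inner A fun w => by
      rw [IsAdjointPair.map_smul (A := A) hD a x]
      simp [mul_sub]
    rwa [e] at h'
  · rw [rangeOneAdd_eq_univ hadj isImaginaryUnit_I hR hS]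
    exact dense_univ

theorem IsSelfAdjointRegularFredholm.exists_stabilityRadius [CompleteSpace E] {t : E →ₗ.[ℂ] E}
    (ht : IsSelfAdjointRegularFredholm A t) : ∃ ε : ℝ, IsFredholmStabilityRadius A t ε := by
  obtain ⟨G, hG⟩ := ht.pseudoLeft
  obtain ⟨H, hH⟩ := ht.pseudoRight
  obtain ⟨G', hG'⟩ := hG.1
  obtain ⟨H', hH'⟩ := hH.1
  -- `M` strictly exceeds all four norms, for the Neumann series, and also `1`, so that `‖D‖ ≤ M⁻¹`
  -- forces `‖D‖ < 1` as regularity requires.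
  set M : ℝ := 1 + ‖G‖ + ‖G'‖ + ‖H‖ + ‖H'‖ + 1 with hM
  have hM0 : 0 < M := by positivity
  have hlt : ∀ r : ℝ, r < M → ∀ D : E →L[ℂ] E, ‖D‖ ≤ M⁻¹ → 0 ≤ r → ‖D‖ * r < 1 := by
    intro r hr D hD h0
    calc ‖D‖ * r ≤ M⁻¹ * r := mul_le_mul_of_nonneg_right hD h0
      _ < M⁻¹ * M := mul_lt_mul_of_pos_left hr (inv_pos.mpr hM0)
      _ = 1 := inv_mul_cancel₀ hM0.ne'
  have n1 := norm_nonneg G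
  have n2 := norm_nonneg G'
  have n3 := norm_nonneg H
  have n4 := norm_nonneg H'
  refine ⟨M⁻¹, inv_pos.mpr hM0, fun D hD hn => ?_⟩
  have hl : ∀ T : E →L[ℂ] E, ‖T‖ < M → ‖D ∘L T‖ < 1 := fun T hT =>
    (D.opNorm_comp_le T).trans_lt (hlt _ hT D hn (norm_nonneg _))
  have hr : ∀ T : E →L[ℂ] E, ‖T‖ < M → ‖T ∘L D‖ < 1 := fun T hT =>
    (T.opNorm_comp_le D).trans_lt (by rw [mul_comm]; exact hlt _ hT D hn (norm_nonneg _))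
  have h1 : ‖D‖ < 1 := by
    simpa using hlt 1 (by linarith) D hn zero_le_one
  refine ⟨ht.regular.addCLM ht.selfAdjoint hD h1,
    adjoint_addCLM ht.regular.dense_domain ht.selfAdjoint hD, ?_, ?_⟩
  · exact exists_isPseudoLeftInverse_addCLM hG' hD hG (hr G (by linarith)) (hl G' (by linarith))
  · exact exists_isPseudoRightInverse_addCLM hH' hD hH (hl H (by linarith)) (hr H' (by linarith))

/-! ### Graph projections -/

variable (A)

/-- The isometry `w ↦ (R w, w - i R w)` onto the graph of `s`, where `R = (s + i)⁻¹`. -/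
def graphIsometry (R : E →L[ℂ] E) : E →L[ℂ] C⋆ᵐᵒᵈ(A, E × E) :=
  (WithCStarModule.equivL ℂ (A := A) (E := E × E)).symm.toContinuousLinearMap ∘L
    (R.prod (1 - Complex.I • R))

/-- The adjoint of `graphIsometry`, where `S = (s - i)⁻¹`. -/
def graphCoisometry (S : E →L[ℂ] E) : C⋆ᵐᵒᵈ(A, E × E) →L[ℂ] E :=
  (S ∘L ContinuousLinearMap.fst ℂ E E +
    (1 + Complex.I • S) ∘L ContinuousLinearMap.snd ℂ E E) ∘L
    (WithCStarModule.equivL ℂ (A := A) (E := E × E)).toContinuousLinearMap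

variable {A}

theorem graphIsometry_fst (R : E →L[ℂ] E) (w : E) : (graphIsometry A R w).1 = R w := rfl

theorem graphIsometry_snd (R : E →L[ℂ] E) (w : E) :
    (graphIsometry A R w).2 = w - Complex.I • R w := rfl

theorem graphCoisometry_apply (S : E →L[ℂ] E) (u : C⋆ᵐᵒᵈ(A, E × E)) :
    graphCoisometry A S u = S u.1 + (u.2 + Complex.I • S u.2) := rfl

theorem mem_graphSubmodule {s : E →ₗ.[ℂ] E} {v : C⋆ᵐᵒᵈ(A, E × E)} :
    v ∈ graphSubmodule A s ↔ (v.1, v.2) ∈ s.graph := Iff.rfl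

theorem IsAdjointPair.inner_graphIsometry {R S : E →L[ℂ] E} (h : IsAdjointPair A R S) (w : E)
    (u : C⋆ᵐᵒᵈ(A, E × E)) :
    inner A (graphIsometry A R w) u = inner A w (graphCoisometry A S u) := by
  rw [WithCStarModule.prod_inner, graphIsometry_fst, graphIsometry_snd, graphCoisometry_apply]
  simp only [CStarModule.inner_add_right, CStarModule.inner_sub_left,
    CStarModule.inner_smul_left_complex, CStarModule.inner_smul_right_complex,
    isImaginaryUnit_I.1, h w, neg_smul, sub_neg_eq_add]

theorem isGraphProjection_comp {s : E →ₗ.[ℂ] E} (hs : IsSymmetricGraph A s) {R S : E →L[ℂ] E}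
    (hR : IsResolvent s Complex.I R) (hS : IsResolvent s (-Complex.I) S) :
    IsGraphProjection A s (graphIsometry A R ∘L graphCoisometry A S) := by
  have hRS := hR.isAdjointPair hS hs isImaginaryUnit_I
  intro u
  refine ⟨hR _, fun v hv => ?_⟩
  rw [mem_graphSubmodule] at hv
  have hx := hR.apply_eq hs isImaginaryUnit_I hv
  set w := v.2 + Complex.I • v.1 with hw
  have hv' : v = graphIsometry A R w := by
    refine (WithCStarModule.equiv A (E × E)).injective (Prod.ext ?_ ?_)
    · exact hx.symm
    · change v.2 = w - Complex.I • R w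
      rw [hx, hw, add_sub_cancel_right]
  have hinner := hs.inner_add_smul isImaginaryUnit_I (hR w) (hR (graphCoisometry A S u))
  rw [sub_add_cancel, sub_add_cancel] at hinner
  rw [CStarModule.inner_sub_right, hv', hRS.inner_graphIsometry, hinner]
  exact sub_self _

/-- `P u - Q u` lies in the graph and is also orthogonal to it. Uniqueness identifies the chosen
`graphProjection` with the explicit `V V*`. -/
theorem IsGraphProjection.unique {s : E →ₗ.[ℂ] E}
    {P Q : C⋆ᵐᵒᵈ(A, E × E) →L[ℂ] C⋆ᵐᵒᵈ(A, E × E)} (hP : IsGraphProjection A s P)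
    (hQ : IsGraphProjection A s Q) : P = Q := by
  ext1 u
  have hmem := (graphSubmodule A s).sub_mem (hP u).1 (hQ u).1
  have h : inner A (P u - Q u) ((u - Q u) - (u - P u)) = 0 := by
    rw [CStarModule.inner_sub_right, (hQ u).2 _ hmem, (hP u).2 _ hmem, sub_zero]
  rw [sub_sub_sub_cancel_left] at h
  exact sub_eq_zero.mp (CStarModule.inner_self.mp h)

theorem IsGraphProjection.graphProjection_eq {s : E →ₗ.[ℂ] E}
    {P : C⋆ᵐᵒᵈ(A, E × E) →L[ℂ] C⋆ᵐᵒᵈ(A, E × E)} (hP : IsGraphProjection A s P) :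
    graphProjection A s = P := by
  have h : ∃ P, IsGraphProjection A s P := ⟨P, hP⟩
  rw [graphProjection, dif_pos h]
  exact h.choose_spec.unique hP

theorem norm_graphIsometry_apply_le {R : E →L[ℂ] E} (hR : ‖R‖ ≤ 1) (w : E) :
    ‖graphIsometry A R w‖ ≤ 3 * ‖w‖ := by
  have h1 : ‖R w‖ ≤ ‖w‖ := (R.le_of_opNorm_le hR w).trans_eq (one_mul _)
  have h2 : ‖w - Complex.I • R w‖ ≤ ‖w‖ + ‖R w‖ := by
    simpa [norm_smul] using norm_sub_le w (Complex.I • R w)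
  have h3 := WithCStarModule.prod_norm_le_norm_add (graphIsometry A R w)
  rw [graphIsometry_fst, graphIsometry_snd] at h3
  linarith

theorem norm_fst_le_norm (u : C⋆ᵐᵒᵈ(A, E × E)) : ‖u.1‖ ≤ ‖u‖ :=
  (le_max_left _ _).trans (WithCStarModule.max_le_prod_norm u)

theorem norm_snd_le_norm (u : C⋆ᵐᵒᵈ(A, E × E)) : ‖u.2‖ ≤ ‖u‖ :=
  (le_max_right _ _).trans (WithCStarModule.max_le_prod_norm u)

theorem norm_graphCoisometry_apply_le {S : E →L[ℂ] E} (hS : ‖S‖ ≤ 1) (u : C⋆ᵐᵒᵈ(A, E × E)) :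
    ‖graphCoisometry A S u‖ ≤ 3 * ‖u‖ := by
  have h1 : ∀ x, ‖S x‖ ≤ ‖x‖ := fun x => (S.le_of_opNorm_le hS x).trans_eq (one_mul _)
  have h2 : ‖S u.1 + (u.2 + Complex.I • S u.2)‖ ≤ ‖S u.1‖ + (‖u.2‖ + ‖S u.2‖) := by
    simpa [norm_smul] using (norm_add_le (S u.1) (u.2 + Complex.I • S u.2)).trans
      (add_le_add_right (norm_add_le u.2 (Complex.I • S u.2)) _)
  rw [graphCoisometry_apply]
  linarith [h1 u.1, h1 u.2, norm_fst_le_norm u, norm_snd_le_norm u]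

theorem norm_graphIsometry_sub_apply_le {R R' : E →L[ℂ] E} {δ : ℝ}
    (h : ∀ w, ‖R w - R' w‖ ≤ δ * ‖w‖) (w : E) :
    ‖graphIsometry A R w - graphIsometry A R' w‖ ≤ 2 * δ * ‖w‖ := by
  have h3 := WithCStarModule.prod_norm_le_norm_add (graphIsometry A R w - graphIsometry A R' w)
  have e : w - Complex.I • R w - (w - Complex.I • R' w) = -(Complex.I • (R w - R' w)) := by module
  rw [WithCStarModule.sub_fst, WithCStarModule.sub_snd, graphIsometry_fst, graphIsometry_snd,
    graphIsometry_fst, graphIsometry_snd, e, norm_neg, norm_smul, Complex.norm_I, one_mul] at h3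
  linarith [h w]

theorem norm_graphCoisometry_sub_apply_le {S S' : E →L[ℂ] E} {δ : ℝ} (hδ : 0 ≤ δ)
    (h : ∀ w, ‖S w - S' w‖ ≤ δ * ‖w‖) (u : C⋆ᵐᵒᵈ(A, E × E)) :
    ‖graphCoisometry A S u - graphCoisometry A S' u‖ ≤ 2 * δ * ‖u‖ := by
  have e : graphCoisometry A S u - graphCoisometry A S' u =
      (S u.1 - S' u.1) + Complex.I • (S u.2 - S' u.2) := by
    rw [graphCoisometry_apply, graphCoisometry_apply]
    module
  rw [e]
  refine (norm_add_le _ _).trans ?_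
  rw [norm_smul, Complex.norm_I, one_mul]
  linarith [h u.1, h u.2, mul_le_mul_of_nonneg_left (norm_fst_le_norm u) hδ,
    mul_le_mul_of_nonneg_left (norm_snd_le_norm u) hδ]

/-- Split `V V* - V' V'* = (V - V') V* + V' (V* - V'*)`. The crude bounds `3` and `2 δ` on the
factors give `2 δ · 3 + 3 · 2 δ = 12 δ`. -/
theorem norm_comp_graphIsometry_sub_le {R S R' S' : E →L[ℂ] E} {δ : ℝ} (hδ : 0 ≤ δ)
    (hS : ‖S‖ ≤ 1) (hR' : ‖R'‖ ≤ 1) (hRR' : ∀ w, ‖R w - R' w‖ ≤ δ * ‖w‖)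
    (hSS' : ∀ w, ‖S w - S' w‖ ≤ δ * ‖w‖) :
    ‖graphIsometry A R ∘L graphCoisometry A S -
      graphIsometry A R' ∘L graphCoisometry A S'‖ ≤ 12 * δ := by
  refine ContinuousLinearMap.opNorm_le_bound _ (by positivity) fun u => ?_
  set w := graphCoisometry A S u with hw
  have e : (graphIsometry A R ∘L graphCoisometry A S -
      graphIsometry A R' ∘L graphCoisometry A S') u = (graphIsometry A R w -
        graphIsometry A R' w) + graphIsometry A R' (w - graphCoisometry A S' u) := by
    rw [map_sub, sub_add_sub_cancel]
    rfl
  rw [e]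
  refine (norm_add_le _ _).trans ?_
  have h1 := norm_graphIsometry_sub_apply_le (A := A) hRR' w
  have h2 := norm_graphIsometry_apply_le (A := A) hR' (w - graphCoisometry A S' u)
  have h3 := norm_graphCoisometry_sub_apply_le hδ hSS' u
  have h4 := mul_le_mul_of_nonneg_left (norm_graphCoisometry_apply_le hS u) hδ
  rw [← hw] at h3 h4
  linarith

/-- The second resolvent estimate. -/
theorem IsResolvent.norm_sub_apply_le {t : E →ₗ.[ℂ] E} {c : ℂ} (hc : IsImaginaryUnit c)
    {D D' R R' : E →L[ℂ] E} (hs : IsSymmetricGraph A (addCLM t D))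
    (hs' : IsSymmetricGraph A (addCLM t D')) (hR : IsResolvent (addCLM t D) c R)
    (hR' : IsResolvent (addCLM t D') c R') (w : E) : ‖R w - R' w‖ ≤ ‖D - D'‖ * ‖w‖ := by
  have h1 := mem_graph_addCLM.mp (hR w)
  have h2 := mem_graph_addCLM.mp (hR' w)
  -- That is, `(t + D + c)(R w - R' w) = -(D - D') R' w`; the lower bound for `t + D + c` then
  -- applies.
  have h3 : (R w - R' w, -(c • (R w - R' w)) - (D - D') (R' w)) ∈ (addCLM t D).graph := by
    rw [mem_graph_addCLM]
    convert t.graph.sub_mem h1 h2 using 1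
    refine Prod.ext rfl ?_
    simp only [sub_apply, map_sub, Prod.snd_sub]
    module
  have h4 := (hs.norm_le hc h3).1
  have e : -(c • (R w - R' w)) - (D - D') (R' w) + c • (R w - R' w) = -((D - D') (R' w)) := by
    abel
  rw [e, norm_neg] at h4
  exact h4.trans ((D - D').le_opNorm_of_le (hR'.norm_apply_le hs' hc w))

theorem isGapContinuous_addCLM [CompleteSpace E] {X : Type*} [TopologicalSpace X]
    {t : E →ₗ.[ℂ] E} {B : X → (E →L[ℂ] E)} (hB : Continuous B)
    (hr : ∀ l, IsRegular A (addCLM t (B l)))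
    (ha : ∀ l, adjoint A (addCLM t (B l)) = addCLM t (B l)) :
    IsGapContinuous A fun l => addCLM t (B l) := by
  have hs : ∀ l, IsSymmetricGraph A (addCLM t (B l)) := fun l =>
    isSymmetricGraph_of_adjoint_eq (hr l).dense_domain (ha l)
  choose R hR using fun l => (hr l).exists_isResolvent (ha l) isImaginaryUnit_I
  choose S hS using fun l => (hr l).exists_isResolvent (ha l) isImaginaryUnit_neg_I
  have hP := fun l => isGraphProjection_comp (hs l) (hR l) (hS l)
  refine ⟨fun l => (hP l).graphProjection_eq ▸ hP l, fun l₀ => ?_⟩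
  have hle : ∀ l, gapDist A (addCLM t (B l)) (addCLM t (B l₀)) ≤ 12 * ‖B l - B l₀‖ := by
    intro l
    rw [gapDist, (hP l).graphProjection_eq, (hP l₀).graphProjection_eq]
    exact norm_comp_graphIsometry_sub_le (norm_nonneg _)
      ((hS l).norm_le_one (hs l) isImaginaryUnit_neg_I)
      ((hR l₀).norm_le_one (hs l₀) isImaginaryUnit_I)
      (IsResolvent.norm_sub_apply_le isImaginaryUnit_I (hs l) (hs l₀) (hR l) (hR l₀))
      (IsResolvent.norm_sub_apply_le isImaginaryUnit_neg_I (hs l) (hs l₀) (hS l) (hS l₀))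
  have hlim : Tendsto (fun l => 12 * ‖B l - B l₀‖) (𝓝 l₀) (𝓝 0) := by
    have hc : Continuous fun l => 12 * ‖B l - B l₀‖ := by fun_prop
    simpa using hc.tendsto l₀
  exact squeeze_zero (fun l => norm_nonneg
    (graphProjection A (addCLM t (B l)) - graphProjection A (addCLM t (B l₀)))) hle hlim

end HilbertCStar

end

theorem mainTheorem11 {A E X : Type*}
    [NonUnitalCStarAlgebra A] [PartialOrder A] [StarOrderedRing A]
    [NormedAddCommGroup E] [NormedSpace ℂ E] [SMul A E] [CStarModule A E] [CompleteSpace E]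
    [TopologicalSpace X]
    (t : E →ₗ.[ℂ] E) (ht : HilbertCStar.IsSelfAdjointRegularFredholm A t) :
    (∃ ε : ℝ, HilbertCStar.IsFredholmStabilityRadius A t ε) ∧
    ∀ ε : ℝ, HilbertCStar.IsFredholmStabilityRadius A t ε →
      ∀ B : X → (E →L[ℂ] E), Continuous B →
        (∀ l : X, HilbertCStar.IsSelfAdjointCLM A (B l)) → (∀ l : X, ‖B l‖ ≤ ε) →
        (∀ l : X, HilbertCStar.IsSelfAdjointRegularFredholm A (HilbertCStar.addCLM t (B l))) ∧
        HilbertCStar.IsGapContinuous A (fun l : X => HilbertCStar.addCLM t (B l)) := by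
  refine ⟨ht.exists_stabilityRadius, fun ε hε B hB hsa hn => ?_⟩
  have h : ∀ l, HilbertCStar.IsSelfAdjointRegularFredholm A (HilbertCStar.addCLM t (B l)) :=
    fun l => hε.2 (B l) (hsa l) (hn l)
  exact ⟨h, HilbertCStar.isGapContinuous_addCLM hB (fun l => (h l).regular)
    fun l => (h l).selfAdjoint⟩
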